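/- Let $\pi=\pi_1\pi_2\cdots\pi_n$ be a permutation of $[n]=\{1,\dots,n\}$ and put $\pi_0=0$. An index $i$ with $1\le i\le n-1$ is an exterior peak of $\pi$ if $\pi_{i-1}<\pi_i>\pi_{i+1}$; it is of pattern $132$ if $\pi_{i-1}<\pi_{i+1}$, and of pattern $231$ if $\pi_{i-1}>\pi_{i+1}$. For $n\ge 0$ let $T(n,i,j)$ be the number of permutations of $[n]$ with exactly $i$ exterior peaks of pattern $132$ and exactly $j$ exterior peaks of pattern $231$, and let $T_n(x,y)=\sum_{i,j\ge 0}T(n,i,j)\,x^iy^j$. Let ${}_1F_1(a;b;z)=\sum_{n\ge 0}\frac{(a)_n}{(b)_n}\frac{z^n}{n!}$, where $(a)_0=1$ and $(a)_n=a(a+1)\cdots(a+n-1)$ for $n>0$. **Theorem.** Let $x\neq y$ be elements of a field $K$ of characteristic zero (for instance, independent indeterminates in $K=\mathbb{Q}(x,y)$, or distinct complex numbers). Then, as formal power series in $t$ over $K$, the denominator on the right-hand side below is invertible, and $$\sum_{n=0}^{\infty}T_n(x,y)\frac{t^n}{n!}=\frac{e^{\frac{x-y}{2}t^2}}{{}_1F_1\!\left(\frac{1-y}{2(x-y)};\frac12;\frac{x-y}{2}t^2\right)-t\;{}_1F_1\!\left(\frac12+\frac{1-y}{2(x-y)};\frac32;\frac{x-y}{2}t^2\right)}.$$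 -/

import Mathlib

namespace ExteriorPeaks

/-- The one-line word `π₁ π₂ ⋯ πₙ` of a permutation of `[n] = {1, …, n}`, extended by `π₀ = 0`.
A permutation of `[n]` is represented as a permutation of `Fin n = {0, …, n - 1}`, with positions
and values shifted by one. The value `0` at indices larger than `n` is never used. -/
def word {n : ℕ} (π : Equiv.Perm (Fin n)) (i : ℕ) : ℕ :=
  if h : 1 ≤ i ∧ i ≤ n then (π ⟨i - 1, by omega⟩ : ℕ) + 1 else 0

/-- `i` is an exterior peak of `π`: `1 ≤ i ≤ n - 1` and `π_{i-1} < π_i > π_{i+1}`. -/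
def IsExteriorPeak {n : ℕ} (π : Equiv.Perm (Fin n)) (i : ℕ) : Prop :=
  1 ≤ i ∧ i < n ∧ word π (i - 1) < word π i ∧ word π (i + 1) < word π i

/-- An exterior peak `i` has pattern 132 if `π_{i-1} < π_{i+1}`. -/
def IsExteriorPeak132 {n : ℕ} (π : Equiv.Perm (Fin n)) (i : ℕ) : Prop :=
  IsExteriorPeak π i ∧ word π (i - 1) < word π (i + 1)

/-- An exterior peak `i` has pattern 231 if `π_{i-1} > π_{i+1}`. -/
def IsExteriorPeak231 {n : ℕ} (π : Equiv.Perm (Fin n)) (i : ℕ) : Prop :=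
  IsExteriorPeak π i ∧ word π (i + 1) < word π (i - 1)

instance {n : ℕ} (π : Equiv.Perm (Fin n)) (i : ℕ) : Decidable (IsExteriorPeak π i) := by
  unfold IsExteriorPeak; infer_instance

instance {n : ℕ} (π : Equiv.Perm (Fin n)) (i : ℕ) : Decidable (IsExteriorPeak132 π i) := by
  unfold IsExteriorPeak132; infer_instance

instance {n : ℕ} (π : Equiv.Perm (Fin n)) (i : ℕ) : Decidable (IsExteriorPeak231 π i) := by
  unfold IsExteriorPeak231; infer_instance

/-- The number of exterior peaks of pattern 132. -/
def ep132 {n : ℕ} (π : Equiv.Perm (Fin n)) : ℕ :=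
  ((Finset.range n).filter (fun i => IsExteriorPeak132 π i)).card

/-- The number of exterior peaks of pattern 231. -/
def ep231 {n : ℕ} (π : Equiv.Perm (Fin n)) : ℕ :=
  ((Finset.range n).filter (fun i => IsExteriorPeak231 π i)).card

/-- `T(n,i,j)`: the number of permutations of `[n]` with `i` exterior peaks of pattern 132 and
`j` exterior peaks of pattern 231. -/
def countT (n i j : ℕ) : ℕ :=
  (Finset.univ.filter (fun π : Equiv.Perm (Fin n) => ep132 π = i ∧ ep231 π = j)).card

/-- `T(n,i,j)` vanishes unless `i ≤ n` and `j ≤ n`. -/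
theorem countT_eq_zero {n i j : ℕ} (h : n < i ∨ n < j) : countT n i j = 0 := by
  unfold countT
  rw [Finset.card_eq_zero, Finset.filter_eq_empty_iff]
  rintro π - ⟨rfl, rfl⟩
  have h1 : ep132 π ≤ n := by
    simpa [ep132] using Finset.card_filter_le (Finset.range n) (fun i => IsExteriorPeak132 π i)
  have h2 : ep231 π ≤ n := by
    simpa [ep231] using Finset.card_filter_le (Finset.range n) (fun i => IsExteriorPeak231 π i)
  omega

/-- `T_n(x,y) = ∑_{i,j ≥ 0} T(n,i,j) xⁱ yʲ`; all terms with `i > n` or `j > n` vanish, by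
`countT_eq_zero`. -/
def polyT {K : Type*} [CommSemiring K] (n : ℕ) (x y : K) : K :=
  ∑ i ∈ Finset.range (n + 1), ∑ j ∈ Finset.range (n + 1), (countT n i j : K) * x ^ i * y ^ j

/-- The exponential generating function `∑ₙ T_n(x,y) tⁿ / n!` as a formal power series in `t`. -/
noncomputable def egfT {K : Type*} [Field K] (x y : K) : PowerSeries K :=
  PowerSeries.mk fun n => polyT n x y / (n.factorial : K)

/-- The confluent hypergeometric series `₁F₁(a; b; z) = ∑ₙ (a)ₙ / (b)ₙ · zⁿ / n!`, as a formal
power series in `z`, where `(a)ₙ = a (a + 1) ⋯ (a + n - 1)`. -/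
noncomputable def confluentF {K : Type*} [Field K] (a b : K) : PowerSeries K :=
  PowerSeries.mk fun n =>
    (ascPochhammer K n).eval a / (ascPochhammer K n).eval b / (n.factorial : K)

/-- The formal power series `c t²` in `t`. -/
noncomputable def quadT {K : Type*} [Field K] (c : K) : PowerSeries K :=
  PowerSeries.C c * PowerSeries.X ^ 2

/-- `c t²` has no constant term, so it may be substituted into any formal power series. -/
theorem hasSubst_quadT {K : Type*} [Field K] (c : K) : PowerSeries.HasSubst (quadT c) :=
  PowerSeries.HasSubst.of_constantCoeff_zero' (by simp [quadT])

/-- The denominator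
`₁F₁((1-y)/(2(x-y)); 1/2; (x-y)/2 · t²) - t ₁F₁(1/2 + (1-y)/(2(x-y)); 3/2; (x-y)/2 · t²)`
as a formal power series in `t`. -/
noncomputable def denomT {K : Type*} [Field K] (x y : K) : PowerSeries K :=
  (confluentF ((1 - y) / (2 * (x - y))) (1 / 2)).subst (quadT ((x - y) / 2))
    - PowerSeries.X *
      (confluentF (1 / 2 + (1 - y) / (2 * (x - y))) (3 / 2)).subst (quadT ((x - y) / 2))

end ExteriorPeaks

/-! Prefixing `π₀ = 0` turns both statistics into a product of weights of consecutive triples. Cut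
the word at its minimal letter `m`. If a smaller letter precedes the word, the part up to `m` is
framed by two smaller letters and the rest is prefixed by `m`; hence `G' = G V` for the generating
functions `G` (prefixed) and `V` (framed).

Cutting a framed word `p … q` with `p < q` gives a framed left part and a right part `m … q` whose
frame is reversed, `m > q`. Reversing a frame changes the weight only when it encloses a single
letter (`y` in place of `x`). Also, `m` is itself a peak only when it is the sole framed letter.
These two corrections give the Riccati equation `V' = V (V - (x-y) t) + (x-1)` (`sum_framed`).

The denominator `D` solves the linearized equation `D'' = (x-y) t D' + (1-y) D`, by Kummer's
equation. Uniqueness yields `D' = D ((x-y) t - V)`, so `(G D)' = (x-y) t G D` and `G D = exp((x-y)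
t²/2)` (`mul_denomT_eq_exp`). -/

open PowerSeries in
/-- A formal solution of `f' = a f` with zero constant term vanishes. -/
theorem PowerSeries.eq_zero_of_derivative_eq_mul {K : Type*} [Field K] [CharZero K]
    {f a : PowerSeries K} (h0 : constantCoeff f = 0) (h : d⁄dX K f = a * f) : f = 0 := by
  ext n
  induction n using Nat.strong_induction_on with
  | _ n ih =>
    cases n with
    | zero => simpa using h0
    | succ n =>
      have h1 := congrArg (coeff n) h
      rw [coeff_derivative, coeff_mul, Finset.sum_eq_zero] at h1
      · have h2 : ((n : K) + 1) ≠ 0 := by exact_mod_cast n.succ_ne_zero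
        simpa [h2] using h1
      · intro p hp
        have := Finset.HasAntidiagonal.mem_antidiagonal.mp hp
        rw [ih p.2 (by omega)]
        simp

namespace ExteriorPeaks

open PowerSeries

/-! ### Kummer's equation and the linear differential equation of the denominator. -/

section Hypergeometric

variable {K : Type*} [Field K]

theorem constantCoeff_subst_quadT (c : K) (f : PowerSeries K) :
    constantCoeff (f.subst (quadT c)) = constantCoeff f := by
  have hs := hasSubst_quadT c
  have h1 : constantCoeff ((f - C (constantCoeff f)).subst (quadT c)) = 0 :=
    constantCoeff_subst_eq_zero
      (show constantCoeff (quadT c) = 0 by simp [quadT]) _ (by simp)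
  have h2 : (C (constantCoeff f)).subst (quadT c) = (C (constantCoeff f) : PowerSeries K) :=
    subst_C _
  have h3 : f.subst (quadT c)
      = (f - C (constantCoeff f)).subst (quadT c) + C (constantCoeff f) := by
    nth_rw 2 [← h2]
    rw [← subst_add hs, sub_add_cancel]
  rw [h3, map_add, h1]
  simp

theorem derivative_quadT (c : K) : d⁄dX K (quadT c) = C (2 * c) * X := by
  rw [quadT, Derivation.leibniz, Derivation.leibniz_pow]
  simp [map_ofNat]
  ring

theorem derivative_subst_quadT (c : K) (f : PowerSeries K) :
    d⁄dX K (f.subst (quadT c)) = (d⁄dX K f).subst (quadT c) * (C (2 * c) * X) := by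
  rw [derivative_subst (hasSubst_quadT c), derivative_quadT]

theorem constantCoeff_confluentF (a b : K) : constantCoeff (confluentF a b) = 1 := by
  simp [confluentF, ← coeff_zero_eq_constantCoeff_apply]

/-- Kummer's differential equation. -/
theorem kummer_confluentF [CharZero K] (a b : K) (hb : ∀ n : ℕ, b + n ≠ 0) :
    X * d⁄dX K (d⁄dX K (confluentF a b)) + (C b - X) * d⁄dX K (confluentF a b)
      = C a * confluentF a b := by
  -- Kummer's equation, read coefficientwise, is this ratio of consecutive coefficients.
  have key : ∀ n : ℕ, coeff (n + 1) (confluentF a b) * (n + 1) * (b + n)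
      = (a + n) * coeff n (confluentF a b) := by
    intro n
    have hp : (ascPochhammer K n).eval b ≠ 0 := by
      induction n with
      | zero => simp
      | succ n ih =>
        rw [ascPochhammer_succ_eval]
        exact mul_ne_zero ih (hb n)
    have h1 := hb n
    have h2 : (n.factorial : K) ≠ 0 := by exact_mod_cast n.factorial_ne_zero
    have h3 : (n : K) + 1 ≠ 0 := by exact_mod_cast n.succ_ne_zero
    simp only [confluentF, coeff_mk, ascPochhammer_succ_eval, Nat.factorial_succ]
    push_cast
    field_simp
  ext n
  have hn := key n
  cases n with
  | zero =>
    have h1 := coeff_derivative (confluentF a b) 0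
    simp only [coeff_zero_eq_constantCoeff, zero_add, Nat.cast_zero, mul_one] at h1
    simpa [sub_mul, h1, mul_comm] using hn
  | succ n =>
    simp only [map_add, map_sub, sub_mul, coeff_succ_X_mul, coeff_C_mul, coeff_derivative]
    push_cast at hn ⊢
    linear_combination hn

theorem subst_kummer [CharZero K] (a b c : K) (hb : ∀ n : ℕ, b + n ≠ 0) :
    quadT c * (d⁄dX K (d⁄dX K (confluentF a b))).subst (quadT c)
      + (C b - quadT c) * (d⁄dX K (confluentF a b)).subst (quadT c)
      = C a * (confluentF a b).subst (quadT c) := by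
  have hs := hasSubst_quadT c
  have h := congrArg (subst (quadT c)) (kummer_confluentF a b hb)
  have hC : ∀ r : K, (C r).subst (quadT c) = (C r : PowerSeries K) := fun r => subst_C r
  rw [sub_mul, subst_add hs, subst_sub hs, subst_mul hs, subst_mul hs, subst_mul hs, subst_mul hs,
    subst_X hs, hC, hC] at h
  rw [sub_mul]
  exact h

theorem derivative_derivative_even [CharZero K] (a c : K) :
    d⁄dX K (d⁄dX K ((confluentF a (1 / 2)).subst (quadT c)))
      = C (2 * c) * X * d⁄dX K ((confluentF a (1 / 2)).subst (quadT c))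
        + C (4 * c * a) * (confluentF a (1 / 2)).subst (quadT c) := by
  have h := subst_kummer a (1 / 2) c (fun n h => by
    have : ((1 + 2 * n : ℕ) : K) = 0 := by push_cast; linear_combination 2 * h
    exact absurd (Nat.cast_eq_zero.mp this) (by omega))
  simp only [derivative_subst_quadT, Derivation.leibniz, smul_eq_mul, derivative_X, derivative_C]
  have h2 : (2 : PowerSeries K) * C (1 / 2) = 1 := by
    rw [← map_ofNat (C (R := K)) 2, ← map_mul]; simp
  simp only [quadT, map_mul, map_ofNat] at h ⊢
  linear_combination 4 * C c * h - (2 * C c) *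
    (d⁄dX K (confluentF a (1 / 2))).subst (C c * X ^ 2) * h2

/-- The factor `X` and the shift of both parameters give the second, odd solution of the equation in
`derivative_derivative_even`. -/
theorem derivative_derivative_odd [CharZero K] (a c : K) :
    d⁄dX K (d⁄dX K (X * (confluentF (1 / 2 + a) (3 / 2)).subst (quadT c)))
      = C (2 * c) * X * d⁄dX K (X * (confluentF (1 / 2 + a) (3 / 2)).subst (quadT c))
        + C (4 * c * a) * (X * (confluentF (1 / 2 + a) (3 / 2)).subst (quadT c)) := by
  have h := subst_kummer (1 / 2 + a) (3 / 2) c (fun n h => by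
    have : ((3 + 2 * n : ℕ) : K) = 0 := by push_cast; linear_combination 2 * h
    exact absurd (Nat.cast_eq_zero.mp this) (by omega))
  simp only [derivative_subst_quadT, Derivation.leibniz, smul_eq_mul, derivative_X, derivative_C,
    map_add, derivative_one]
  have h2 : (2 : PowerSeries K) * C (1 / 2) = 1 := by
    rw [← map_ofNat (C (R := K)) 2, ← map_mul]; simp
  have h3 : (2 : PowerSeries K) * C (3 / 2) = 3 := by
    have e := congrArg (C (R := K)) (show (2 : K) * (3 / 2) = 3 by field_simp)
    rwa [map_mul, map_ofNat, map_ofNat] at e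
  simp only [quadT, map_mul, map_add, map_ofNat] at h ⊢
  linear_combination 4 * C c * X * h + (2 * C c) * X *
    (confluentF (1 / 2 + a) (3 / 2)).subst (C c * X ^ 2) * h2 - (2 * C c) * X *
    (d⁄dX K (confluentF (1 / 2 + a) (3 / 2))).subst (C c * X ^ 2) * h3

theorem derivative_derivative_denomT [CharZero K] (x y : K) (hxy : x ≠ y) :
    d⁄dX K (d⁄dX K (denomT x y))
      = C (x - y) * X * d⁄dX K (denomT x y) + C (1 - y) * denomT x y := by
  have h : x - y ≠ 0 := sub_ne_zero.mpr hxy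
  have h1 := derivative_derivative_even ((1 - y) / (2 * (x - y))) ((x - y) / 2)
  have h2 := derivative_derivative_odd ((1 - y) / (2 * (x - y))) ((x - y) / 2)
  -- The parameters of the theorem are those for which `2c = x - y` and `4ca = 1 - y`.
  have e1 : 2 * ((x - y) / 2) = x - y := by field_simp
  have e2 : 4 * ((x - y) / 2) * ((1 - y) / (2 * (x - y))) = 1 - y := by field_simp; ring
  rw [e1, e2] at h1 h2
  rw [denomT, map_sub, map_sub, h1, h2]
  ring

theorem constantCoeff_denomT (x y : K) : constantCoeff (denomT x y) = 1 := by
  simp [denomT, constantCoeff_subst_quadT, constantCoeff_confluentF]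

theorem constantCoeff_derivative_denomT (x y : K) :
    constantCoeff (d⁄dX K (denomT x y)) = -1 := by
  simp [denomT, derivative_subst_quadT, Derivation.leibniz, constantCoeff_subst_quadT,
    constantCoeff_confluentF]

/-- The differential system satisfied by the generating functions `G` and `V` determines `G`. -/
theorem mul_denomT_eq_exp [CharZero K] (x y : K) (hxy : x ≠ y) (G V : PowerSeries K)
    (hG0 : constantCoeff G = 1) (hV0 : constantCoeff V = 1) (hG : d⁄dX K G = G * V)
    (hV : d⁄dX K V = V * (V - C (x - y) * X) + C (x - 1)) :
    G * denomT x y = (exp K).subst (quadT ((x - y) / 2)) := by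
  set D := denomT x y
  set E := (exp K).subst (quadT ((x - y) / 2)) with hE
  have hD := derivative_derivative_denomT x y hxy
  -- The defect `Z` of the first-order equation satisfies `Z' = V Z`, where the Riccati equation
  -- cancels the multiples of `D`; and `Z(0) = -1 + 1 = 0`.
  have hZ : d⁄dX K D - D * (C (x - y) * X - V) = 0 := by
    apply eq_zero_of_derivative_eq_mul (a := V)
    · simp [D, constantCoeff_denomT, constantCoeff_derivative_denomT, hV0]
    · simp only [map_sub, Derivation.leibniz, smul_eq_mul, derivative_X, derivative_C, hV, D, hD,
        map_one]
      ring
  have hE' : d⁄dX K E = C (x - y) * X * E := by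
    rw [hE, derivative_subst_quadT, derivative_exp, mul_div_cancel₀ _ (two_ne_zero' K), mul_comm]
  refine sub_eq_zero.mp (eq_zero_of_derivative_eq_mul (a := C (x - y) * X) ?_ ?_)
  · simp [D, E, hG0, constantCoeff_denomT, constantCoeff_subst_quadT]
  · rw [map_sub]
    simp only [Derivation.leibniz, smul_eq_mul, hE', hG]
    linear_combination G * hZ

end Hypergeometric

end ExteriorPeaks

/-! ### Arrangements of finite sets and their decomposition at a letter. -/

namespace ExteriorPeaks

/-- The linear arrangements of a finite set, as lists. -/
def arrangements (s : Finset ℕ) : Finset (List ℕ) :=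
  ⟨s.val.lists, Multiset.lists_nodup_finset s⟩

theorem mem_arrangements {s : Finset ℕ} {l : List ℕ} :
    l ∈ arrangements s ↔ l.Nodup ∧ ∀ a, a ∈ l ↔ a ∈ s := by
  rw [arrangements, Finset.mem_mk, Multiset.mem_lists_iff]
  constructor
  · intro h
    have h' : s.val = (l : Multiset ℕ) := h
    refine ⟨?_, fun a => ?_⟩
    · rw [← Multiset.coe_nodup, ← h']; exact s.nodup
    · rw [← Finset.mem_val, h', Multiset.mem_coe]
  · rintro ⟨h1, h2⟩
    exact (Multiset.Nodup.ext s.nodup (Multiset.coe_nodup.mpr h1)).mpr fun a => by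
      rw [Multiset.mem_coe, h2, Finset.mem_val]

theorem length_of_mem_arrangements {s : Finset ℕ} {l : List ℕ} (h : l ∈ arrangements s) :
    l.length = s.card := by
  rw [mem_arrangements] at h
  rw [← List.toFinset_card_of_nodup h.1]
  congr 1
  ext a
  simp [h.2]

theorem arrangements_empty : arrangements ∅ = {[]} := by
  ext l
  rw [mem_arrangements, Finset.mem_singleton]
  constructor
  · rintro ⟨-, h⟩
    exact List.eq_nil_iff_forall_not_mem.mpr fun a ha => by simpa using (h a).mp ha
  · rintro rfl
    simp

/-- An arrangement of `insert m s` is a pair of arrangements of complementary subsets of `s`,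
placed before and after `m`. -/
theorem sum_arrangements_insert {M : Type*} [AddCommMonoid M] {s : Finset ℕ} {m : ℕ} (hm : m ∉ s)
    (f : List ℕ → M) :
    ∑ l ∈ arrangements (insert m s), f l = ∑ u ∈ s.powerset, ∑ l₁ ∈ arrangements u,
      ∑ l₂ ∈ arrangements (s \ u), f (l₁ ++ m :: l₂) := by
  simp_rw [← Finset.sum_product', Finset.sum_sigma']
  symm
  refine Finset.sum_bij (fun p _ => p.2.1 ++ m :: p.2.2) ?_ ?_ ?_ (fun _ _ => rfl)
  · rintro ⟨u, l₁, l₂⟩ h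
    simp only [Finset.mem_sigma, Finset.mem_powerset, Finset.mem_product, mem_arrangements,
      Finset.mem_sdiff] at h
    obtain ⟨hu, ⟨h1, h1'⟩, h2, h2'⟩ := h
    rw [mem_arrangements, List.nodup_append]
    refine ⟨⟨h1, List.nodup_cons.mpr ⟨?_, h2⟩, ?_⟩, ?_⟩
    · rw [h2']
      exact fun h => hm h.1
    · rintro a ha b hb rfl
      rw [h1'] at ha
      rcases List.mem_cons.mp hb with rfl | hb
      · exact hm (hu ha)
      · exact ((h2' _).mp hb).2 ha
    · intro a
      rw [List.mem_append, List.mem_cons, h1', h2', Finset.mem_insert]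
      have := @hu a
      tauto
  · rintro ⟨u, l₁, l₂⟩ h ⟨u', l₁', l₂'⟩ h' he
    simp only [Finset.mem_sigma, Finset.mem_powerset, Finset.mem_product, mem_arrangements,
      Finset.mem_sdiff] at h h' he
    have n1 : m ∉ l₁ := fun hh => hm (h.1 ((h.2.1.2 m).mp hh))
    have n2 : m ∉ l₂ := fun hh => hm ((h.2.2.2 m).mp hh).1
    obtain ⟨rfl, -, rfl⟩ := (List.append_cons_inj_of_notMem n1 n2).mp he
    obtain rfl : u = u' := by
      ext a
      rw [← h.2.1.2, ← h'.2.1.2]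
    rfl
  · intro l hl
    rw [mem_arrangements] at hl
    obtain ⟨l₁, l₂, rfl⟩ := List.append_of_mem ((hl.2 m).mpr (Finset.mem_insert_self m s))
    obtain ⟨hn, hl⟩ := hl
    rw [List.nodup_append, List.nodup_cons] at hn
    obtain ⟨h1, ⟨h2, h3⟩, h4⟩ := hn
    refine ⟨⟨l₁.toFinset, l₁, l₂⟩, ?_, rfl⟩
    have key : ∀ a, a ∈ l₁ → a ≠ m := fun a ha => h4 a ha m (by simp)
    have key2 : ∀ a, a ∈ l₁ → a ∉ l₂ := fun a ha hb => h4 a ha a (by simp [hb]) rfl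
    simp only [Finset.mem_sigma, Finset.mem_powerset, Finset.mem_product, mem_arrangements,
      Finset.mem_sdiff, List.mem_toFinset, implies_true, and_true]
    refine ⟨fun a ha => ?_, h1, h3, fun a => ?_⟩
    · have ha := List.mem_toFinset.mp ha
      have := (hl a).mp (by simp [ha])
      exact (Finset.mem_insert.mp this).resolve_left (key a ha)
    · have h5 := hl a
      simp only [List.mem_append, List.mem_cons, Finset.mem_insert] at h5
      constructor
      · intro ha
        have hne : a ≠ m := fun h => h2 (h ▸ ha)
        exact ⟨(h5.mp (Or.inr (Or.inr ha))).resolve_left hne, fun h => key2 a h ha⟩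
      · rintro ⟨ha, hb⟩
        have hne : a ≠ m := fun h => hm (h ▸ ha)
        tauto

/-! ### Triple weights and the recursion at the minimal letter. -/

section Weight

variable {K : Type*} [Field K]

/-- The weight of three consecutive letters: `x` for a peak of pattern 132, `y` for a peak of
pattern 231, and `1` otherwise. -/
def tripleWeight (x y : K) (a b c : ℕ) : K :=
  if a < b ∧ c < b then if a < c then x else if c < a then y else 1 else 1

/-- The product of the weights of all consecutive triples of a word. -/
def wordWeight (x y : K) : List ℕ → K
  | a :: b :: c :: l => tripleWeight x y a b c * wordWeight x y (b :: c :: l)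
  | _ => 1

variable (x y : K)

/-- Only the triple centred at `m` is lost by the cut, and the hypothesis says that `m` is not a
peak. -/
theorem wordWeight_append (l₁ l₂ : List ℕ) (m : ℕ)
    (h : ∀ a ∈ l₁.getLast?, ∀ b ∈ l₂.head?, a < m → m ≤ b) :
    wordWeight x y (l₁ ++ m :: l₂) = wordWeight x y (l₁ ++ [m]) * wordWeight x y (m :: l₂) := by
  induction l₁ with
  | nil => simp [wordWeight]
  | cons a l ih =>
    match l with
    | [] =>
      match l₂ with
      | [] => simp [wordWeight]
      | b :: l₂ =>
        have h' : a < m → m ≤ b := by simpa using h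
        have : tripleWeight x y a m b = 1 := if_neg fun hh => by have := h' hh.1; omega
        simp [wordWeight, this]
    | [b] =>
      have ih := ih (by simpa using h)
      simp only [List.cons_append, List.nil_append, wordWeight] at ih ⊢
      rw [ih]
      ring
    | b :: c :: l =>
      have ih := ih (by simpa using h)
      simp only [List.cons_append, wordWeight] at ih ⊢
      rw [ih]
      ring

/-- A last letter below all others occurs in at most one triple, whose weight is `y` or `1`
according to the order of the other two letters. -/
theorem wordWeight_change_last (a q m : ℕ) (l : List ℕ) (hqa : q < a) (hma : m < a)
    (hq : ∀ b ∈ l, q < b) (hm : ∀ b ∈ l, m < b) :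
    wordWeight x y (a :: (l ++ [q])) = wordWeight x y (a :: (l ++ [m])) := by
  induction l generalizing a with
  | nil => simp [wordWeight]
  | cons b l ih =>
    have ih := ih b (hq b (by simp)) (hm b (by simp)) (fun b hb => hq b (by simp [hb]))
      (fun b hb => hm b (by simp [hb]))
    cases l with
    | nil =>
      have := hq b (by simp)
      have := hm b (by simp)
      have : tripleWeight x y a b q = tripleWeight x y a b m := by
        simp only [tripleWeight]
        split_ifs <;> first | rfl | omega
      simp [wordWeight, this]
    | cons c l =>
      simp only [List.cons_append, wordWeight] at ih ⊢
      rw [ih]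

/-- With two or more inner letters the ends lie in different triples, and each is smaller than the
other letters there. With a single inner letter both ends share a triple and their order decides
between `x` and `y`. -/
theorem wordWeight_swap_ends {q m : ℕ} {l : List ℕ} (hl : l.length ≠ 1)
    (hq : ∀ b ∈ l, q < b) (hm : ∀ b ∈ l, m < b) :
    wordWeight x y (m :: (l ++ [q])) = wordWeight x y (q :: (l ++ [m])) := by
  match l with
  | [] => simp [wordWeight]
  | [b] => simp at hl
  | b :: c :: l =>
    simp only [List.mem_cons, forall_eq_or_imp] at hq hm
    have h1 := wordWeight_change_last x y b q m (c :: l) hq.1 hm.1 (by simpa using hq.2)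
      (by simpa using hm.2)
    have h2 : tripleWeight x y m b c = tripleWeight x y q b c := by
      simp only [tripleWeight]
      split_ifs <;> first | rfl | omega
    simp only [List.cons_append, wordWeight] at h1 ⊢
    rw [h1, h2]

/-- The total weight of the arrangements of an `n`-set, framed by smaller letters `p < q` on the
left and on the right. -/
def framedWeight : ℕ → K
  | 0 => 1
  | n + 1 => ∑ k : Fin (n + 1), (n.choose k : K) * (framedWeight k *
      (framedWeight (n - k) - if n - k = 1 then x - y else 0)) + if n = 0 then x - 1 else 0

/-- The total weight of the arrangements of an `n`-set, preceded by a smaller letter. -/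
def prefixedWeight : ℕ → K
  | 0 => 1
  | n + 1 => ∑ k : Fin (n + 1), (n.choose k : K) * (framedWeight x y k * prefixedWeight (n - k))

theorem framedWeight_succ (n : ℕ) : framedWeight x y (n + 1) =
    ∑ k ∈ Finset.range (n + 1), n.choose k • (framedWeight x y k *
      (framedWeight x y (n - k) - if n - k = 1 then x - y else 0)) +
        if n = 0 then x - 1 else 0 := by
  rw [framedWeight, Finset.sum_range]
  simp

theorem prefixedWeight_succ (n : ℕ) : prefixedWeight x y (n + 1) =
    ∑ k ∈ Finset.range (n + 1), n.choose k • (framedWeight x y k *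
      prefixedWeight x y (n - k)) := by
  rw [prefixedWeight, Finset.sum_range]
  simp

theorem exists_min_insert {s : Finset ℕ} {n : ℕ} (h : s.card = n + 1) :
    ∃ (m : ℕ) (t : Finset ℕ), m ∉ t ∧ s = insert m t ∧ t.card = n ∧ ∀ a ∈ t, m < a := by
  have hs : s.Nonempty := Finset.card_pos.mp (by omega)
  refine ⟨s.min' hs, s.erase (s.min' hs), Finset.notMem_erase _ _,
    (Finset.insert_erase (s.min'_mem hs)).symm, ?_, fun a ha => s.min'_lt_of_mem_erase_min' hs ha⟩
  rw [Finset.card_erase_of_mem (s.min'_mem hs), h, Nat.add_sub_cancel]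

/-- Cutting at the minimum `m` leaves the frames `p < m` and `m > q`; the second must be reversed
before induction applies. -/
theorem sum_framed (n : ℕ) : ∀ (s : Finset ℕ) (p q : ℕ), s.card = n → p < q → (∀ a ∈ s, q < a) →
    ∑ l ∈ arrangements s, wordWeight x y (p :: (l ++ [q])) = framedWeight x y n := by
  induction n using Nat.strong_induction_on with
  | _ n ih =>
    intro s p q hs hpq hq
    cases n with
    | zero =>
      rw [Finset.card_eq_zero.mp hs, arrangements_empty]
      simp [wordWeight, framedWeight]
    | succ n =>
      obtain ⟨m, t, hmt, rfl, ht, hlt⟩ := exists_min_insert hs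
      have hqm : q < m := hq m (by simp)
      have hqt : ∀ a ∈ t, q < a := fun a ha => hq a (by simp [ha])
      have hright : ∀ u : Finset ℕ, u ⊆ t →
          ∑ l ∈ arrangements u, wordWeight x y (m :: (l ++ [q]))
            = framedWeight x y u.card - if u.card = 1 then x - y else 0 := by
        intro u hu
        have hv := ih u.card (by have := Finset.card_le_card hu; omega) u q m rfl hqm
          (fun a ha => hlt a (hu ha))
        by_cases h1 : u.card = 1
        · obtain ⟨b, rfl⟩ := Finset.card_eq_one.mp h1
          have hb : m < b := hlt b (hu (by simp))
          have hqb : q < b := by omega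
          have ha : arrangements {b} = {[b]} := by
            ext l
            rw [Finset.mem_singleton]
            constructor
            · intro hl
              obtain ⟨c, rfl⟩ := List.length_eq_one_iff.mp
                ((length_of_mem_arrangements hl).trans (by simp))
              have := ((mem_arrangements.mp hl).2 c).mp (by simp)
              rw [Finset.mem_singleton.mp this]
            · rintro rfl
              simp [mem_arrangements]
          rw [← hv, ha]
          -- Here `m b q` has weight `y`, while `q b m` has weight `x`.
          simp [wordWeight, tripleWeight, hb, hqb, hqm, hqm.le]
        · rw [if_neg h1, sub_zero, ← hv]
          refine Finset.sum_congr rfl fun l hl => ?_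
          have hmem := (mem_arrangements.mp hl).2
          exact wordWeight_swap_ends x y (by rwa [length_of_mem_arrangements hl])
            (fun b hb => hqt b (hu ((hmem b).mp hb))) (fun b hb => hlt b (hu ((hmem b).mp hb)))
      rw [sum_arrangements_insert hmt]
      have hsplit : ∀ u ∈ t.powerset, ∑ l₁ ∈ arrangements u, ∑ l₂ ∈ arrangements (t \ u),
          wordWeight x y (p :: (l₁ ++ m :: l₂ ++ [q]))
          = framedWeight x y u.card * (framedWeight x y (n - u.card)
            - if n - u.card = 1 then x - y else 0) + if n = 0 then x - 1 else 0 := by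
        intro u hu
        rw [Finset.mem_powerset] at hu
        have hcard := Finset.card_le_card hu
        -- For `n = 0` the word is `p m q`, of weight `x`, whereas the product of the parts is `1`;
        -- the term `x - 1` corrects this.
        by_cases hn : n = 0
        · subst hn
          obtain rfl := Finset.card_eq_zero.mp ht
          obtain rfl := Finset.subset_empty.mp hu
          simp [arrangements_empty, wordWeight, tripleWeight, framedWeight, hpq, hqm,
            hpq.trans hqm]
        · rw [if_neg hn, add_zero, ← ht, ← Finset.card_sdiff_of_subset hu,
            ← hright _ Finset.sdiff_subset,
            ← ih u.card (by omega) u p m rfl (hpq.trans hqm) (fun a ha => hlt a (hu ha)),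
            Finset.sum_mul_sum]
          refine Finset.sum_congr rfl fun l₁ h₁ => Finset.sum_congr rfl fun l₂ h₂ => ?_
          have := wordWeight_append x y (p :: l₁) (l₂ ++ [q]) m ?_
          · simpa using this
          · intro a ha b hb _
            cases l₂ with
            | cons c l₂ =>
              obtain rfl : c = b := by simpa using hb
              have := ((mem_arrangements.mp h₂).2 c).mp (by simp)
              exact (hlt c (Finset.sdiff_subset this)).le
            -- If nothing follows `m`, then `l₁` is nonempty, so the letter before `m` exceeds `m`.
            | nil =>
              exfalso
              have hl₂ := length_of_mem_arrangements h₂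
              rw [Finset.card_sdiff_of_subset hu] at hl₂
              have hl₁ := length_of_mem_arrangements h₁
              have hne : l₁ ≠ [] := by
                rintro rfl
                simp at hl₁ hl₂
                omega
              rw [List.getLast?_cons, List.getLast?_eq_some_getLast hne] at ha
              have ha' : l₁.getLast hne = a := by simpa using ha
              have hmem : a ∈ l₁ := ha' ▸ List.getLast_mem hne
              have := hlt a (hu (((mem_arrangements.mp h₁).2 a).mp hmem))
              omega
      rw [Finset.sum_congr rfl hsplit, Finset.sum_add_distrib, framedWeight_succ,
        Finset.sum_powerset_apply_card (fun k => framedWeight x y k * (framedWeight x y (n - k)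
            - if n - k = 1 then x - y else 0)), ht]
      congr 1
      -- The correction is summed over `2 ^ n` subsets, but it is nonzero only for `n = 0`.
      rw [Finset.sum_const, Finset.card_powerset, ht]
      split_ifs with hn <;> simp [hn]

theorem sum_prefixed (n : ℕ) : ∀ (s : Finset ℕ) (p : ℕ), s.card = n → (∀ a ∈ s, p < a) →
    ∑ l ∈ arrangements s, wordWeight x y (p :: l) = prefixedWeight x y n := by
  induction n using Nat.strong_induction_on with
  | _ n ih =>
    intro s p hs hp
    cases n with
    | zero =>
      rw [Finset.card_eq_zero.mp hs, arrangements_empty]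
      simp [wordWeight, prefixedWeight]
    | succ n =>
      obtain ⟨m, t, hmt, rfl, ht, hlt⟩ := exists_min_insert hs
      have hpm : p < m := hp m (by simp)
      rw [sum_arrangements_insert hmt, prefixedWeight_succ, ← ht,
        ← Finset.sum_powerset_apply_card (fun k => framedWeight x y k *
          prefixedWeight x y (t.card - k))]
      refine Finset.sum_congr rfl fun u hu => ?_
      rw [Finset.mem_powerset] at hu
      have hcard := Finset.card_le_card hu
      rw [← Finset.card_sdiff_of_subset hu,
        ← sum_framed x y u.card u p m rfl hpm (fun a ha => hlt a (hu ha)),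
        ← ih (t \ u).card (by have := Finset.card_le_card (Finset.sdiff_subset (s := t) (t := u));
                              omega) (t \ u) m rfl
          (fun a ha => hlt a (Finset.sdiff_subset ha)), Finset.sum_mul_sum]
      refine Finset.sum_congr rfl fun l₁ h₁ => Finset.sum_congr rfl fun l₂ h₂ => ?_
      refine wordWeight_append x y (p :: l₁) l₂ m fun a _ b hb _ => ?_
      have := ((mem_arrangements.mp h₂).2 b).mp (List.mem_of_mem_head? hb)
      exact (hlt b (Finset.sdiff_subset this)).le

end Weight

end ExteriorPeaks

namespace ExteriorPeaks

/-! ### From permutations to weighted words. -/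

section Permutations

variable {K : Type*} [Field K] (x y : K)

theorem wordWeight_map_range (n : ℕ) (f : ℕ → ℕ) :
    wordWeight x y ((List.range (n + 1)).map f)
      = ∏ i ∈ Finset.range (n - 1), tripleWeight x y (f i) (f (i + 1)) (f (i + 2)) := by
  induction n generalizing f with
  | zero => simp [wordWeight]
  | succ n ih =>
    cases n with
    | zero => simp [wordWeight, List.range_succ]
    | succ n =>
      have ih := ih (fun i => f (i + 1))
      rw [Nat.add_sub_cancel] at ih ⊢
      rw [Finset.prod_range_succ', mul_comm, ← ih]
      simp [List.range_succ_eq_map, wordWeight, Function.comp_def]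

theorem word_zero {n : ℕ} (π : Equiv.Perm (Fin n)) : word π 0 = 0 := by
  simp [word]

theorem word_succ {n : ℕ} (π : Equiv.Perm (Fin n)) (i : Fin n) : word π (i + 1) = π i + 1 := by
  have : 1 ≤ (i : ℕ) + 1 ∧ (i : ℕ) + 1 ≤ n := ⟨by omega, i.2⟩
  simp [word, this]

theorem tripleWeight_word {n : ℕ} (π : Equiv.Perm (Fin n)) (i : ℕ) (hi : i + 1 < n) :
    tripleWeight x y (word π i) (word π (i + 1)) (word π (i + 2))
      = (if IsExteriorPeak132 π (i + 1) then x else 1)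
        * if IsExteriorPeak231 π (i + 1) then y else 1 := by
  -- Distinct neighbours rule out the tie branch of `tripleWeight`, so every peak has one of the two
  -- patterns.
  have hne : word π i ≠ word π (i + 2) := by
    have h2 := word_succ π ⟨i + 1, hi⟩
    simp only at h2
    cases i with
    | zero => rw [word_zero, h2]; omega
    | succ i =>
      have h1 := word_succ π ⟨i, by omega⟩
      simp only at h1
      rw [h1, h2]
      intro h
      have := π.injective (Fin.ext (Nat.add_right_cancel h))
      simp only [Fin.mk.injEq] at this
      omega
  have h3 : i + 1 - 1 = i := rfl
  have h4 : i + 1 + 1 = i + 2 := rfl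
  simp only [tripleWeight, IsExteriorPeak132, IsExteriorPeak231, IsExteriorPeak, h3, h4]
  rcases lt_or_gt_of_ne hne with h | h
  · simp [h, h.asymm, hi]
  · simp [h, h.asymm, hi]

theorem pow_ep132_mul_pow_ep231 {n : ℕ} (π : Equiv.Perm (Fin n)) :
    x ^ ep132 π * y ^ ep231 π = wordWeight x y ((List.range (n + 1)).map (word π)) := by
  rw [wordWeight_map_range, ep132, ep231, Finset.card_filter, Finset.card_filter,
    ← Finset.prod_pow_eq_pow_sum, ← Finset.prod_pow_eq_pow_sum, ← Finset.prod_mul_distrib]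
  cases n with
  | zero => simp
  | succ n =>
    -- Index `0` is split off, since it is never a peak; the other indices are the centres of the
    -- triples.
    rw [Finset.prod_range_succ', Nat.add_sub_cancel]
    have h1 : ¬ IsExteriorPeak132 π 0 := fun h => absurd h.1.1 (by omega)
    have h2 : ¬ IsExteriorPeak231 π 0 := fun h => absurd h.1.1 (by omega)
    simp only [h1, h2, if_false, pow_zero, mul_one]
    refine Finset.prod_congr rfl fun i hi => ?_
    rw [tripleWeight_word x y π i (by have := Finset.mem_range.mp hi; omega)]
    split_ifs <;> simp

theorem polyT_eq_sum (n : ℕ) :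
    polyT n x y = ∑ π : Equiv.Perm (Fin n), x ^ ep132 π * y ^ ep231 π := by
  have hle : ∀ π : Equiv.Perm (Fin n), ep132 π < n + 1 ∧ ep231 π < n + 1 := fun π =>
    ⟨Nat.lt_succ_of_le ((Finset.card_filter_le _ _).trans (by simp)),
      Nat.lt_succ_of_le ((Finset.card_filter_le _ _).trans (by simp))⟩
  rw [polyT, ← Finset.sum_product', ← Finset.sum_fiberwise_of_maps_to
    (s := Finset.univ) (t := Finset.range (n + 1) ×ˢ Finset.range (n + 1))
    (g := fun π : Equiv.Perm (Fin n) => (ep132 π, ep231 π))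
    (fun π _ => by simpa using hle π)]
  refine Finset.sum_congr rfl fun p _ => ?_
  rw [countT, mul_assoc, ← nsmul_eq_mul, ← Finset.sum_const]
  refine Finset.sum_congr (by ext; simp [Prod.ext_iff]) fun π hπ => ?_
  have := (Finset.mem_filter.mp hπ).2
  rw [← this]

/-- Permutations correspond to the arrangements of `{1, …, n}`. -/
theorem sum_perm_eq_sum_arrangements {M : Type*} [AddCommMonoid M] (n : ℕ) (f : List ℕ → M) :
    ∑ π : Equiv.Perm (Fin n), f ((List.range n).map fun i => word π (i + 1))
      = ∑ l ∈ arrangements (Finset.Icc 1 n), f l := by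
  have hlist : ∀ π : Equiv.Perm (Fin n),
      ((List.range n).map fun i => word π (i + 1)) = List.ofFn fun i => (π i : ℕ) + 1 := by
    intro π
    refine List.ext_getElem (by simp) fun i h₁ h₂ => ?_
    have hi : i < n := by simpa using h₁
    simpa using word_succ π ⟨i, hi⟩
  simp_rw [hlist]
  refine Finset.sum_bij (fun π _ => List.ofFn fun i => (π i : ℕ) + 1) ?_ ?_ ?_ (fun _ _ => rfl)
  · intro π _
    rw [mem_arrangements, List.nodup_ofFn]
    refine ⟨fun i j h => π.injective (Fin.ext (Nat.add_right_cancel h)), fun a => ?_⟩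
    rw [List.mem_ofFn', Set.mem_range, Finset.mem_Icc]
    constructor
    · rintro ⟨i, rfl⟩
      have := (π i).2
      omega
    · rintro ⟨h1, h2⟩
      refine ⟨π.symm ⟨a - 1, by omega⟩, ?_⟩
      simp
      omega
  · intro π _ σ _ h
    ext i
    exact Nat.add_right_cancel (congrFun (List.ofFn_injective h) i)
  · intro l hl
    have hlen : l.length = n := by rw [length_of_mem_arrangements hl]; simp
    subst hlen
    rw [mem_arrangements] at hl
    have hmem : ∀ i : Fin l.length, 1 ≤ l[i] ∧ l[i] ≤ l.length := fun i =>
      Finset.mem_Icc.mp ((hl.2 _).mp (List.getElem_mem i.2))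
    let g : Fin l.length → Fin l.length := fun i => ⟨l[i] - 1, by have := hmem i; omega⟩
    have hg : Function.Injective g := by
      intro i j h
      have h1 := hmem i
      have h2 := hmem j
      have h3 : l[i] - 1 = l[j] - 1 := congrArg Fin.val h
      have h4 : l[(i : ℕ)] = l[(j : ℕ)] := by
        simp only [Fin.getElem_fin] at h1 h2 h3
        omega
      exact Fin.ext ((List.Nodup.getElem_inj_iff hl.1).mp h4)
    refine ⟨Equiv.ofBijective g (Finite.injective_iff_bijective.mp hg), Finset.mem_univ _, ?_⟩
    refine List.ext_getElem (by simp) fun i h₁ h₂ => ?_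
    have := hmem ⟨i, h₂⟩
    simp only [Fin.getElem_fin] at this
    simp [g]
    omega

/-- The convention `π₀ = 0` supplies the smaller prefix letter. The last position is never an
exterior peak, so no letter is needed on the right. -/
theorem polyT_eq_prefixedWeight (n : ℕ) : polyT n x y = prefixedWeight x y n := by
  rw [polyT_eq_sum, ← sum_prefixed x y n (Finset.Icc 1 n) 0 (by simp)
    (fun a ha => (Finset.mem_Icc.mp ha).1), ← sum_perm_eq_sum_arrangements]
  refine Finset.sum_congr rfl fun π _ => ?_
  rw [pow_ep132_mul_pow_ep231, List.range_succ_eq_map]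
  simp [word_zero, Function.comp_def]

end Permutations

/-! ### Recursions as differential equations for exponential generating functions. -/

section GeneratingFunction

open PowerSeries

variable {K : Type*} [Field K]

/-- The exponential generating function of a sequence. -/
noncomputable def egf (a : ℕ → K) : PowerSeries K :=
  PowerSeries.mk fun n => a n / (n.factorial : K)

theorem constantCoeff_egf (a : ℕ → K) : constantCoeff (egf a) = a 0 := by
  simp [egf, ← coeff_zero_eq_constantCoeff_apply]

theorem derivative_egf [CharZero K] (a : ℕ → K) : d⁄dX K (egf a) = egf fun n => a (n + 1) := by
  ext n
  have h2 : (n.factorial : K) ≠ 0 := by exact_mod_cast n.factorial_ne_zero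
  have h3 : (n : K) + 1 ≠ 0 := by exact_mod_cast n.succ_ne_zero
  rw [coeff_derivative, egf, egf, coeff_mk, coeff_mk, Nat.factorial_succ]
  push_cast
  field_simp

theorem egf_mul [CharZero K] (a b : ℕ → K) : egf a * egf b
    = egf fun n => ∑ k ∈ Finset.range (n + 1), n.choose k • (a k * b (n - k)) := by
  ext n
  rw [coeff_mul, Finset.Nat.sum_antidiagonal_eq_sum_range_succ_mk]
  simp only [egf, coeff_mk]
  rw [Finset.sum_div]
  refine Finset.sum_congr rfl fun k hk => ?_
  have hk : k ≤ n := Nat.lt_succ_iff.mp (Finset.mem_range.mp hk)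
  have h (n : ℕ) : (n.factorial : K) ≠ 0 := by exact_mod_cast n.factorial_ne_zero
  rw [nsmul_eq_mul, Nat.cast_choose K hk]
  have h1 := h n
  have h2 := h k
  have h3 := h (n - k)
  field_simp

theorem egf_add (a b : ℕ → K) : egf a + egf b = egf fun n => a n + b n := by
  ext n
  simp [egf, add_div]

theorem egf_sub (a b : ℕ → K) : egf a - egf b = egf fun n => a n - b n := by
  ext n
  simp [egf, sub_div]

theorem C_mul_X_eq_egf (r : K) : C r * X = egf fun n => if n = 1 then r else 0 := by
  ext n
  rw [egf, coeff_C_mul, coeff_X, coeff_mk]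
  split_ifs with h <;> simp [h]

theorem C_eq_egf (r : K) : C r = egf fun n => if n = 0 then r else 0 := by
  ext n
  rw [egf, coeff_C, coeff_mk]
  split_ifs with h <;> simp [h]

theorem derivative_egf_framedWeight [CharZero K] (x y : K) :
    d⁄dX K (egf (framedWeight x y))
      = egf (framedWeight x y) * (egf (framedWeight x y) - C (x - y) * X) + C (x - 1) := by
  rw [derivative_egf, C_mul_X_eq_egf, C_eq_egf, egf_sub, egf_mul, egf_add]
  simp_rw [framedWeight_succ]

theorem derivative_egf_prefixedWeight [CharZero K] (x y : K) :
    d⁄dX K (egf (prefixedWeight x y)) = egf (prefixedWeight x y) * egf (framedWeight x y) := by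
  rw [derivative_egf, mul_comm, egf_mul]
  simp_rw [prefixedWeight_succ]

end GeneratingFunction

end ExteriorPeaks

/-- The identity holds in `K⟦t⟧` for all `x ≠ y` in a field `K` of characteristic zero; this
includes independent indeterminates `x, y` (in `K = ℚ(x, y)`) and real or complex numbers. The first
conjunct says that the denominator is invertible, so that the inverse in the second is genuine. -/
theorem mainTheorem5 {K : Type*} [Field K] [CharZero K] (x y : K) (hxy : x ≠ y) :
    IsUnit (ExteriorPeaks.denomT x y) ∧
    ExteriorPeaks.egfT x y =
      (PowerSeries.exp K).subst (ExteriorPeaks.quadT ((x - y) / 2)) *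
        (ExteriorPeaks.denomT x y)⁻¹ := by
  have hD := ExteriorPeaks.constantCoeff_denomT x y
  refine ⟨PowerSeries.isUnit_iff_constantCoeff.mpr (by rw [hD]; exact isUnit_one), ?_⟩
  have hG : ExteriorPeaks.egfT x y = ExteriorPeaks.egf (ExteriorPeaks.prefixedWeight x y) := by
    simp only [ExteriorPeaks.egfT, ExteriorPeaks.egf, ExteriorPeaks.polyT_eq_prefixedWeight]
  rw [hG, PowerSeries.eq_mul_inv_iff_mul_eq (by rw [hD]; exact one_ne_zero)]
  exact ExteriorPeaks.mul_denomT_eq_exp x y hxy _ _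
    (by rw [ExteriorPeaks.constantCoeff_egf, ExteriorPeaks.prefixedWeight])
    (by rw [ExteriorPeaks.constantCoeff_egf, ExteriorPeaks.framedWeight])
    (ExteriorPeaks.derivative_egf_prefixedWeight x y)
    (ExteriorPeaks.derivative_egf_framedWeight x y)
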